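/- **Setting.** A POMDP $\mathcal P=\langle S,O,A,R,p,\omega,\gamma,\mu\rangle$ has finite sets $S$ (states), $O$ (observations), $A\neq\emptyset$ (actions), $R\subset\mathbb R$ (rewards), dynamics $p(s',r\mid s,a)$, observation probabilities $\omega(o\mid s)$, initial distribution $\mu$ and discount factor $\gamma\in[0,1]$. There may be a (possibly empty) set of terminal states, at which an episode ends. If $\gamma=1$, assume that every episode ends with probability one, from every state and however the actions are chosen. Write $p(s'\mid s,a)=\sum_r p(s',r\mid s,a)$. A history is a sequence $H=(o_0,a_0,\dots,a_{t-1},o_t)$; it is possible if it can occur in a running (not yet ended) episode when its actions are executed. The belief state $b(H)$ of a possible history is the distribution of the current (non-terminal) state: $b(o_0)(s)\propto\mu(s)\,\omega(o_0\mid s)$ and $b(H,a,o)(s')\propto\omega(o\mid s')\sum_{s}p(s'\mid s,a)\,b(H)(s)$, for non-terminal $s,s'$. A history-based policy assigns to every history a distribution on $A$; a memoryless policy assigns a distribution on actions to every observation. The value of a policy is its expected discounted return from the start of an episode, and an optimal policy maximizes the value in its class. An external memory for $\mathcal P$ is $\mathcal M_{\mathcal P}=\langle M,W,\Gamma,\eta\rangle$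 with finite sets $M$ (memory states) and $W$ (writing actions), a writing distribution $\Gamma(m'\mid m,w,o,a,r,o')$ and an initial distribution $\eta$ on $M$. The memory-augmented environment $\mathcal E=\langle\mathcal P,\mathcal M_{\mathcal P}\rangle$ is the POMDP with states $S\times M\times O$, observations $M\times O$, actions $A\times W$, the same rewards, discount factor and episode ends, initial probabilities $\mu(s)\eta(m)\omega(o\mid s)$ and dynamics $p(s',r\mid s,a)\,\Gamma(m'\mid m,w,o,a,r,o')\,\omega(o'\mid s')$; a state $(s,m,o)$ shows the observation $(m,o)$. For $f:M\times O\times A\to W$ and a history $H$, let $\Omega_f(H)\subseteq M$ be the set of last memory states of the possible histories of $\mathcal E$ that project to $H$ and in which every writing action is $w_i=f(m_i,o_i,a_i)$. The memory is sufficiently expressive for $\mathcal P$ if there is an $f$ such that $\Omega_f(H^1)\cap\Omega_f(H^2)=\emptyset$ for all possible histories $H^1,H^2$ of $\mathcal P$ with the same last observation and $b(H^1)\ne b(H^2)$. **Proposition.** Suppose that $\mathcal M_{\mathcal P}$ is sufficiently expressive for $\mathcal P$. Then every history-based policy of $\mathcal P$ and every memoryless policy of $\mathcal E$ has a value, an optimal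 history-based policy of $\mathcal P$ and an optimal memoryless policy of $\mathcal E$ exist, and: 1. The optimal memoryless policy of $\mathcal E$ is as good as the optimal history-based policy of $\mathcal P$: its value is at least as large. 2. The two optimal values are equal if the memory obtains no information from the rewards beyond $(o,a,o')$, that is, if $\Gamma(\cdot\mid m,w,o,a,r_1,o')=\Gamma(\cdot\mid m,w,o,a,r_2,o')$ for all $m,w$ whenever each of $r_1,r_2$ can occur together with $(o,a,o')$ in a transition between non-terminal states (for instance, if $\Gamma$ does not depend on $r$). 3. There are a memoryless policy $\pi_{\mathcal E}$ of $\mathcal E$ and an optimal history-based policy $\pi^*$ of $\mathcal P$ such that $\sum_{w}\pi_{\mathcal E}\big((a,w)\mid m_t,o_t\big)=\pi^*(a\mid o_0,a_0,\dots,o_t)$ for all $a\in A$ and every history of $\mathcal E$ (with last observation $(m_t,o_t)$ and projection $(o_0,a_0,\dots,o_t)$ to $\mathcal P$) that has positive probability in a running episode under $\pi_{\mathcal E}$. -/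

import Mathlib

open Filter Topology

/-- A POMDP `⟨S, O, A, R, p, ω, γ, μ⟩` with finite sets of states, observations, actions and
(real) rewards. `p s a (s', r)` is `p(s', r | s, a)` and `ω s o` is `ω(o | s)`. An episode ends as
soon as it reaches a state of `terminal`; this set may be empty (episodes that never end), and the
values of `p` at terminal states are irrelevant. -/
structure POMDP (S O A : Type*) (R : Finset ℝ) [Fintype S] [Fintype O] where
  p : S → A → stdSimplex ℝ (S × R)
  ω : S → stdSimplex ℝ O
  γ : ℝ
  γ_nonneg : 0 ≤ γ
  γ_le_one : γ ≤ 1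
  μ : stdSimplex ℝ S
  terminal : Set S

/-- Observation-action histories `o₀, a₀, o₁, …, a_{t-1}, o_t`. -/
inductive History (O A : Type*) where
  | start (o : O) : History O A
  | step (h : History O A) (a : A) (o : O) : History O A

/-- The last observation of a history. -/
def History.last {O A : Type*} : History O A → O
  | .start o => o
  | .step _ _ o => o

/-- History-based policies `π(a_t | o₀, a₀, …, a_{t-1}, o_t)`. -/
abbrev HistoryPolicy (O A : Type*) [Fintype A] := History O A → stdSimplex ℝ A

/-- Memoryless policies `π(a_t | o_t)`. -/
abbrev MemorylessPolicy (O A : Type*) [Fintype A] := O → stdSimplex ℝ A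

/-- A memoryless policy, seen as a history-based one. -/
def MemorylessPolicy.toHistory {O A : Type*} [Fintype A] (π : MemorylessPolicy O A) :
    HistoryPolicy O A :=
  fun h => π h.last

namespace POMDP

variable {S O A : Type*} {R : Finset ℝ} [Fintype S] [Fintype O]

/-- The state-transition probability `p(s' | s, a) = ∑ r, p(s', r | s, a)`. -/
noncomputable def trans (P : POMDP S O A R) (s : S) (a : A) (s' : S) : ℝ :=
  ∑ r, P.p s a (s', r)

open Classical in
/-- The joint weight of `s₀ = s` and the first observation `o` (non-terminal states only). -/
noncomputable def init (P : POMDP S O A R) (o : O) : S → ℝ :=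
  fun s => if s ∈ P.terminal then 0 else P.μ s * P.ω s o

open Classical in
/-- One unnormalised filtering step: `s' ↦ ω(o | s') ∑ s, p(s' | s, a) v(s)` (non-terminal `s'`
only: the episode is still running when the agent acts). -/
noncomputable def update (P : POMDP S O A R) (v : S → ℝ) (a : A) (o : O) : S → ℝ :=
  fun s' => if s' ∈ P.terminal then 0 else P.ω s' o * ∑ s, P.trans s a s' * v s

/-- The belief state of a history: the recursively computed and normalised distribution of the
current state. (It is a probability vector for every history that can occur.) -/
noncomputable def belief (P : POMDP S O A R) : History O A → S → ℝ
  | .start o => fun s => P.init o s / ∑ x, P.init o x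
  | .step h a o => fun s => P.update (P.belief h) a o s / ∑ x, P.update (P.belief h) a o x

/-- The probability that, if the actions of `h` are executed, the observations of `h` are
received, the episode is still running, and the current state is `s`. -/
noncomputable def forward (P : POMDP S O A R) : History O A → S → ℝ
  | .start o => P.init o
  | .step h a o => P.update (P.forward h) a o

/-- The history can occur, in a running episode, when its actions are executed. -/
def Possible (P : POMDP S O A R) (h : History O A) : Prop :=
  ∃ s, 0 < P.forward h s

/-- The product of the probabilities with which `π` chooses the actions of a history. -/
noncomputable def _root_.HistoryPolicy.weight [Fintype A] (π : HistoryPolicy O A) :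
    History O A → ℝ
  | .start _ => 1
  | .step h a _ => HistoryPolicy.weight π h * π h a

/-- The probability that a running episode has the history `h` when `π` is followed. -/
noncomputable def historyProb [Fintype A] (P : POMDP S O A R) (π : HistoryPolicy O A)
    (h : History O A) : ℝ :=
  π.weight h * ∑ s, P.forward h s

open Classical in
/-- Expected discounted sum of the next `n` rewards when `π` is followed, the history is `h` and
the current state is `s`. -/
noncomputable def returnFrom [Fintype A] (P : POMDP S O A R) (π : HistoryPolicy O A) :
    ℕ → History O A → S → ℝ
  | 0, _, _ => 0
  | n + 1, h, s =>
    if s ∈ P.terminal then 0 else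
      ∑ a, π h a * ∑ x : S × R, P.p s a x *
        ((x.2 : ℝ) + P.γ * ∑ o, P.ω x.1 o * P.returnFrom π n (h.step a o) x.1)

/-- Expected discounted sum of the first `n` rewards of an episode when `π` is followed. -/
noncomputable def returnUpTo [Fintype A] (P : POMDP S O A R) (π : HistoryPolicy O A) (n : ℕ) : ℝ :=
  ∑ s, P.μ s * ∑ o, P.ω s o * P.returnFrom π n (.start o) s

/-- The expected discounted return of `π` exists and equals `v`. -/
def HasValue [Fintype A] (P : POMDP S O A R) (π : HistoryPolicy O A) (v : ℝ) : Prop :=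
  Tendsto (P.returnUpTo π) atTop (𝓝 v)

/-- `π` is an optimal history-based policy. -/
def IsOptimal [Fintype A] (P : POMDP S O A R) (π : HistoryPolicy O A) : Prop :=
  ∃ v, P.HasValue π v ∧ ∀ π' v', P.HasValue π' v' → v' ≤ v

/-- `π` is an optimal memoryless policy. -/
def IsOptimalMemoryless [Fintype A] (P : POMDP S O A R) (π : MemorylessPolicy O A) : Prop :=
  ∃ v, P.HasValue π.toHistory v ∧
    ∀ (π' : MemorylessPolicy O A) (v' : ℝ), P.HasValue π'.toHistory v' → v' ≤ v

open Classical in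
/-- The probability that an episode started in `s` is still running after `n` steps when the
actions are chosen by `σ` from the current state. -/
noncomputable def running (P : POMDP S O A R) (σ : S → A) : ℕ → S → ℝ
  | 0, s => if s ∈ P.terminal then 0 else 1
  | n + 1, s => if s ∈ P.terminal then 0 else ∑ s', P.trans s (σ s) s' * P.running σ n s'

/-- Every episode ends with probability one, from every state, however the actions are chosen.
(In a finite decision process it is enough to consider choices `σ : S → A`.) -/
def EpisodesEnd (P : POMDP S O A R) : Prop :=
  ∀ (σ : S → A) (s : S), Tendsto (fun n => P.running σ n s) atTop (𝓝 0)

end POMDP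

/-- An external memory `⟨M, W, Γ, η⟩` for a POMDP with observations `O`, actions `A`, rewards `R`.
`Γ m w o a r o' m'` is `Γ(m' | m, w, o, a, r, o')`. -/
structure ExternalMemory (O A : Type*) (R : Finset ℝ) (M W : Type*) [Fintype M] where
  Γ : M → W → O → A → R → O → stdSimplex ℝ M
  η : stdSimplex ℝ M

namespace POMDP

variable {S O A M W : Type*} {R : Finset ℝ} [Fintype S] [Fintype O] [Fintype M]

open Classical in
/-- The memory-augmented environment `⟨P, N⟩`, as the POMDP with states `S × M × O`, observations
`M × O` and actions `A × W`. -/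
noncomputable def augment (P : POMDP S O A R) (N : ExternalMemory O A R M W) :
    POMDP (S × M × O) (M × O) (A × W) R where
  p := fun x b =>
    ⟨fun y => P.p x.1 b.1 (y.1.1, y.2) * N.Γ x.2.1 b.2 x.2.2 b.1 y.2 y.1.2.2 y.1.2.1 *
        P.ω y.1.1 y.1.2.2, by
      refine ⟨fun y => mul_nonneg (mul_nonneg (stdSimplex.zero_le _ _) (stdSimplex.zero_le _ _))
        (stdSimplex.zero_le _ _), ?_⟩
      have key : ∀ (s' : S) (r : R), ∑ m' : M, ∑ o' : O, P.p x.1 b.1 (s', r) *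
          N.Γ x.2.1 b.2 x.2.2 b.1 r o' m' * P.ω s' o' = P.p x.1 b.1 (s', r) := by
        intro s' r
        rw [Finset.sum_comm]
        simp_rw [← Finset.sum_mul, ← Finset.mul_sum, stdSimplex.sum_eq_one, mul_one,
          ← Finset.mul_sum, stdSimplex.sum_eq_one, mul_one]
      have h1 := stdSimplex.sum_eq_one (P.p x.1 b.1)
      rw [Fintype.sum_prod_type] at h1
      rw [Finset.sum_comm] at h1
      rw [Fintype.sum_prod_type_right]
      refine Eq.trans ?_ h1
      refine Fintype.sum_congr _ _ fun r => ?_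
      simp_rw [Fintype.sum_prod_type]
      exact Fintype.sum_congr _ _ fun s' => key s' r⟩
  ω := fun x => ⟨fun y => if y = x.2 then 1 else 0,
    ⟨fun y => by dsimp only; split_ifs <;> norm_num, by simp⟩⟩
  γ := P.γ
  γ_nonneg := P.γ_nonneg
  γ_le_one := P.γ_le_one
  μ := ⟨fun x => P.μ x.1 * N.η x.2.1 * P.ω x.1 x.2.2,
    ⟨fun x => mul_nonneg (mul_nonneg (stdSimplex.zero_le _ _) (stdSimplex.zero_le _ _))
        (stdSimplex.zero_le _ _), by
      simp_rw [Fintype.sum_prod_type, ← Finset.mul_sum, stdSimplex.sum_eq_one, mul_one,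
        ← Finset.mul_sum, stdSimplex.sum_eq_one, mul_one, stdSimplex.sum_eq_one]⟩⟩
  terminal := {x | x.1 ∈ P.terminal}

end POMDP

namespace History

variable {O A M W : Type*}

/-- The history in the original POMDP that underlies a history in the memory-augmented
environment. -/
def env : History (M × O) (A × W) → History O A
  | .start x => .start x.2
  | .step h b x => .step (env h) b.1 x.2

/-- Every memory-writing action in the history is the one chosen by the memory-update function
`f : M × O × A → W`. -/
def Follows (f : M × O × A → W) : History (M × O) (A × W) → Prop
  | .start _ => True
  | .step h b _ => Follows f h ∧ b.2 = f (h.last.1, h.last.2, b.1)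

end History

namespace ExternalMemory

variable {S O A M W : Type*} {R : Finset ℝ} [Fintype S] [Fintype O] [Fintype M]

/-- `Ω_f(H)`: the possible last memory states of the augmented histories that are generated from
the history `H` with the memory-update function `f`. -/
def lastMemoryStates (N : ExternalMemory O A R M W) (P : POMDP S O A R) (f : M × O × A → W)
    (H : History O A) : Set M :=
  {m | ∃ h : History (M × O) (A × W),
    h.env = H ∧ h.Follows f ∧ (P.augment N).Possible h ∧ h.last.1 = m}

/-- The external memory is sufficiently expressive for `P`. -/
def SufficientlyExpressive (N : ExternalMemory O A R M W) (P : POMDP S O A R) : Prop :=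
  ∃ f : M × O × A → W, ∀ H₁ H₂ : History O A, P.Possible H₁ → P.Possible H₂ →
    H₁.last = H₂.last → P.belief H₁ ≠ P.belief H₂ →
      Disjoint (N.lastMemoryStates P f H₁) (N.lastMemoryStates P f H₂)

/-- The memory learns nothing from rewards that `(o, a, o')` does not tell: any two rewards that
can both occur, in a running episode, together with `o, a, o'` have the same effect on it. This
holds in particular if `Γ` does not depend on the reward. -/
def NoRewardInformation (N : ExternalMemory O A R M W) (P : POMDP S O A R) : Prop :=
  ∀ (o : O) (a : A) (o' : O) (r₁ r₂ : R),
    (∃ s s', s ∉ P.terminal ∧ s' ∉ P.terminal ∧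
      0 < P.ω s o ∧ 0 < P.p s a (s', r₁) ∧ 0 < P.ω s' o') →
    (∃ s s', s ∉ P.terminal ∧ s' ∉ P.terminal ∧
      0 < P.ω s o ∧ 0 < P.p s a (s', r₂) ∧ 0 < P.ω s' o') →
    ∀ m w, N.Γ m w o a r₁ o' = N.Γ m w o a r₂ o'

end ExternalMemory

/-! Belief states are sufficient statistics, and expressive memory determines them.

All limits rest on a `ContractingWeight`: a state weight `w` that discounted transitions shrink by a
factor `ρ < 1` while the episode runs. For `γ < 1` take `w = 1`. If instead every episode ends, a
finite sum of maximal survival probabilities works. Truncated returns are then Cauchy with error of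
order `ρ ^ n`, uniformly in the policy, so values exist. The value is therefore continuous in the
policy, and compactness gives an optimal memoryless policy.

For history-based policies, dynamic programming runs on unnormalised beliefs. `optimalReturn` bounds
every policy and converges to a solution of the Bellman equation that is homogeneous under
nonnegative scaling. Homogeneity lets an action be chosen greedily from the normalised belief, and
this greedy policy attains the limit (`exists_optimal_beliefPolicy`).

If the memory is written with the function `f` of the expressiveness condition, the pair (memory
state, observation) determines the belief. A memoryless policy can thus copy the greedy belief
policy (`exists_memoryless_eq_beliefPolicy`), and equal action probabilities give equal returns
(`returnUpTo_augment_eq`). This yields parts 1 and 3. The inequality need not be an equality in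
general, since recorded rewards may reveal more about the state than the history does. When they add
nothing, each memory update is a random draw independent of the hidden state given the history, and
homogeneity shows that it cannot help (`NoRewardInformation.returnUpTo_le`). -/

namespace stdSimplex

variable {ι : Type*} [Fintype ι]

theorem sum_mul_le (p : stdSimplex ℝ ι) {f : ι → ℝ} {c : ℝ} (h : ∀ i, f i ≤ c) :
    ∑ i, p i * f i ≤ c :=
  calc ∑ i, p i * f i ≤ ∑ i, p i * c :=
        Finset.sum_le_sum fun i _ => mul_le_mul_of_nonneg_left (h i) (zero_le p i)
    _ = c := by rw [← Finset.sum_mul, sum_eq_one, one_mul]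

theorem abs_sum_mul_le (p : stdSimplex ℝ ι) {f : ι → ℝ} {c : ℝ} (h : ∀ i, |f i| ≤ c) :
    |∑ i, p i * f i| ≤ c := by
  refine (Finset.abs_sum_le_sum_abs _ _).trans ?_
  simp_rw [abs_mul, abs_of_nonneg (zero_le p _)]
  exact sum_mul_le p h

end stdSimplex

/-! ### Rewards and contracting weights. -/

namespace POMDP

section General

variable {S O A : Type*} {R : Finset ℝ} [Fintype S] [Fintype O]

theorem trans_nonneg (P : POMDP S O A R) (s : S) (a : A) (s' : S) : 0 ≤ P.trans s a s' :=
  Finset.sum_nonneg fun _ _ => stdSimplex.zero_le _ _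

theorem sum_trans (P : POMDP S O A R) (s : S) (a : A) : ∑ s', P.trans s a s' = 1 := by
  simp_rw [trans]
  rw [← stdSimplex.sum_eq_one (P.p s a), Fintype.sum_prod_type]

/-- The expected immediate reward. -/
noncomputable def reward (P : POMDP S O A R) (s : S) (a : A) : ℝ :=
  ∑ x : S × R, P.p s a x * (x.2 : ℝ)

/-- A bound on the absolute values of the rewards. -/
noncomputable def rewardBound (_ : POMDP S O A R) : ℝ := ∑ r : R, |(r : ℝ)|

theorem rewardBound_nonneg (P : POMDP S O A R) : 0 ≤ P.rewardBound :=
  Finset.sum_nonneg fun _ _ => abs_nonneg _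

theorem abs_reward_le (P : POMDP S O A R) (s : S) (a : A) : |P.reward s a| ≤ P.rewardBound :=
  stdSimplex.abs_sum_mul_le _ fun x =>
    Finset.single_le_sum (f := fun r : R => |(r : ℝ)|) (fun _ _ => abs_nonneg _)
      (Finset.mem_univ x.2)

/-- A weight function on the states for which the discounted transitions are a contraction
while the episode is running. -/
structure ContractingWeight (P : POMDP S O A R) (w : S → ℝ) (ρ : ℝ) : Prop where
  rate_nonneg : 0 ≤ ρ
  rate_lt_one : ρ < 1
  nonneg : ∀ s, 0 ≤ w s
  one_le : ∀ s ∉ P.terminal, 1 ≤ w s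
  contract : ∀ s ∉ P.terminal, ∀ a, P.γ * ∑ s', P.trans s a s' * w s' ≤ ρ * w s

open Classical in
/-- The maximal probability that an episode started in `s` is still running after `n` steps. -/
noncomputable def maxRunning [Fintype A] [Nonempty A] (P : POMDP S O A R) : ℕ → S → ℝ
  | 0, s => if s ∈ P.terminal then 0 else 1
  | n + 1, s => if s ∈ P.terminal then 0 else
      Finset.univ.sup' Finset.univ_nonempty fun a => ∑ s', P.trans s a s' * P.maxRunning n s'

/-! ### Survival probabilities and the contracting weight when episodes end. -/

section Running

variable [Fintype A] [Nonempty A]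

theorem maxRunning_terminal (P : POMDP S O A R) (n : ℕ) {s : S} (hs : s ∈ P.terminal) :
    P.maxRunning n s = 0 := by
  cases n <;> simp [maxRunning, hs]

theorem maxRunning_succ (P : POMDP S O A R) (n : ℕ) {s : S} (hs : s ∉ P.terminal) :
    P.maxRunning (n + 1) s =
      Finset.univ.sup' Finset.univ_nonempty fun a => ∑ s', P.trans s a s' * P.maxRunning n s' := by
  simp [maxRunning, hs]

theorem le_maxRunning_succ (P : POMDP S O A R) (n : ℕ) {s : S} (hs : s ∉ P.terminal) (a : A) :
    ∑ s', P.trans s a s' * P.maxRunning n s' ≤ P.maxRunning (n + 1) s := by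
  rw [maxRunning_succ P n hs]
  exact Finset.le_sup' (fun a => ∑ s', P.trans s a s' * P.maxRunning n s') (Finset.mem_univ a)

theorem maxRunning_nonneg (P : POMDP S O A R) (n : ℕ) (s : S) : 0 ≤ P.maxRunning n s := by
  induction n generalizing s with
  | zero => simp only [maxRunning]; split_ifs <;> norm_num
  | succ n ih =>
    by_cases hs : s ∈ P.terminal
    · rw [maxRunning_terminal P _ hs]
    · exact (Finset.sum_nonneg fun s' _ => mul_nonneg (P.trans_nonneg _ _ _) (ih s')).trans
        (P.le_maxRunning_succ n hs (Classical.arbitrary A))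

theorem maxRunning_antitone (P : POMDP S O A R) (s : S) :
    Antitone fun n => P.maxRunning n s := by
  refine antitone_nat_of_succ_le fun n => ?_
  induction n generalizing s with
  | zero =>
    by_cases hs : s ∈ P.terminal
    · simp [maxRunning_terminal P _ hs]
    · rw [maxRunning_succ P _ hs]
      refine Finset.sup'_le _ _ fun a _ => ?_
      have h0 : P.maxRunning 0 s = 1 := by simp [maxRunning, hs]
      rw [h0, ← P.sum_trans s a]
      refine Finset.sum_le_sum fun s' _ => mul_le_of_le_one_right (P.trans_nonneg _ _ _) ?_
      simp only [maxRunning]; split_ifs <;> norm_num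
  | succ n ih =>
    by_cases hs : s ∈ P.terminal
    · simp [maxRunning_terminal P _ hs]
    · rw [maxRunning_succ P _ hs]
      refine Finset.sup'_le _ _ fun a _ => le_trans ?_ (P.le_maxRunning_succ n hs a)
      exact Finset.sum_le_sum fun s' _ => mul_le_mul_of_nonneg_left (ih s') (P.trans_nonneg _ _ _)

/-- `EpisodesEnd` speaks only of stationary choices, whereas `maxRunning` allows a new choice at
each step. The decreasing limit `u` satisfies the optimality equation because finite maxima commute
with limits. A stationary choice `σ` greedy for `u` then survives with probability at least `u` at
every time, which forces `u = 0`. -/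
theorem EpisodesEnd.tendsto_maxRunning {P : POMDP S O A R} (hP : P.EpisodesEnd) (s : S) :
    Tendsto (fun n => P.maxRunning n s) atTop (𝓝 0) := by
  have hlim : ∀ s, Tendsto (fun n => P.maxRunning n s) atTop (𝓝 (⨅ n, P.maxRunning n s)) :=
    fun s => tendsto_atTop_ciInf (P.maxRunning_antitone s)
      ⟨0, by rintro _ ⟨n, rfl⟩; exact P.maxRunning_nonneg n s⟩
  set u : S → ℝ := fun s => ⨅ n, P.maxRunning n s with hu
  have hle : ∀ n s, u s ≤ P.maxRunning n s := fun n s =>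
    (P.maxRunning_antitone s).le_of_tendsto (hlim s) n
  have hut : ∀ s ∈ P.terminal, u s = 0 := fun s hs =>
    tendsto_nhds_unique (hlim s) (by simp [maxRunning_terminal P _ hs])
  have hfix : ∀ s ∉ P.terminal, u s =
      Finset.univ.sup' Finset.univ_nonempty fun a => ∑ s', P.trans s a s' * u s' := by
    intro s hs
    refine tendsto_nhds_unique ((tendsto_add_atTop_iff_nat 1).2 (hlim s)) ?_
    simp_rw [maxRunning_succ P _ hs]
    exact Tendsto.finset_sup'_nhds_apply Finset.univ_nonempty fun a _ =>
      tendsto_finsetSum _ fun s' _ => (hlim s').const_mul _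
  have hmax : ∀ s, ∃ a, ∀ a', ∑ s', P.trans s a' s' * u s' ≤ ∑ s', P.trans s a s' * u s' :=
    fun s => Finite.exists_max fun a => ∑ s', P.trans s a s' * u s'
  choose σ hσ using hmax
  have hrun : ∀ n s, u s ≤ P.running σ n s := by
    intro n
    induction n with
    | zero =>
      intro s
      refine (hle 0 s).trans_eq ?_
      simp only [maxRunning, running]
    | succ n ih =>
      intro s
      by_cases hs : s ∈ P.terminal
      · simp [hut s hs, running, hs]
      · rw [hfix s hs]
        simp only [running, hs, if_false]
        refine Finset.sup'_le _ _ fun a _ => (hσ s a).trans ?_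
        exact Finset.sum_le_sum fun s' _ =>
          mul_le_mul_of_nonneg_left (ih s') (P.trans_nonneg _ _ _)
  have hu0 : u s = 0 := le_antisymm (ge_of_tendsto' (hP σ s) fun n => hrun n s)
    (le_ciInf fun n => P.maxRunning_nonneg n s)
  rw [← hu0]
  exact hlim s

theorem EpisodesEnd.exists_contractingWeight {P : POMDP S O A R} (hP : P.EpisodesEnd) :
    ∃ w ρ, P.ContractingWeight w ρ := by
  obtain ⟨N, hN⟩ : ∃ N, ∀ s, P.maxRunning N s ≤ 1 / 2 :=
    (eventually_all.2 fun s =>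
      ((hP.tendsto_maxRunning s).eventually_le_const (by norm_num))).exists
  set w : S → ℝ := fun s => 2 * ∑ i ∈ Finset.range N, P.maxRunning i s with hw
  have hw0 : ∀ s, 0 ≤ w s := fun s =>
    mul_nonneg zero_le_two (Finset.sum_nonneg fun i _ => P.maxRunning_nonneg i s)
  -- One transition shifts the summation index by one. The sum telescopes to a change of at most `2
  -- * (maxRunning N s - maxRunning 0 s) ≤ 2 * (1 / 2 - 1) = -1`.
  have hdec : ∀ s ∉ P.terminal, ∀ a, ∑ s', P.trans s a s' * w s' ≤ w s - 1 := by
    intro s hs a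
    have h1 : ∑ s', P.trans s a s' * w s' =
        2 * ∑ i ∈ Finset.range N, ∑ s', P.trans s a s' * P.maxRunning i s' := by
      rw [Finset.sum_comm, Finset.mul_sum]
      refine Finset.sum_congr rfl fun s' _ => ?_
      rw [hw, ← Finset.mul_sum]
      ring
    have h2 : ∑ i ∈ Finset.range N, ∑ s', P.trans s a s' * P.maxRunning i s' ≤
        ∑ i ∈ Finset.range N, P.maxRunning (i + 1) s :=
      Finset.sum_le_sum fun i _ => P.le_maxRunning_succ i hs a
    have h3 := Finset.sum_range_succ (fun i => P.maxRunning i s) N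
    rw [Finset.sum_range_succ'] at h3
    have h4 : P.maxRunning 0 s = 1 := by simp [maxRunning, hs]
    have h5 := hN s
    rw [h1, hw]
    dsimp only
    linarith
  have hw1 : ∀ s ∉ P.terminal, 1 ≤ w s := by
    intro s hs
    have h1 := hdec s hs (Classical.arbitrary A)
    have h2 : 0 ≤ ∑ s', P.trans s (Classical.arbitrary A) s' * w s' :=
      Finset.sum_nonneg fun s' _ => mul_nonneg (P.trans_nonneg _ _ _) (hw0 s')
    linarith
  -- Any bound `B ≥ 1` of `w` turns the additive decrease into a factor: `w s - 1 ≤ (1 - 1 / B) * w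
  -- s`.
  set B : ℝ := 1 + ∑ s, w s with hB
  have hwB : ∀ s, w s ≤ B := fun s => by
    have := Finset.single_le_sum (f := w) (fun s _ => hw0 s) (Finset.mem_univ s)
    linarith
  have hB1 : 1 ≤ B := by
    have := Finset.sum_nonneg fun s (_ : s ∈ Finset.univ) => hw0 s
    linarith
  have hB0 : 0 < B := by linarith
  refine ⟨w, 1 - 1 / B, ?_, ?_, hw0, hw1, ?_⟩
  · have : 1 / B ≤ 1 := by rw [div_le_one hB0]; exact hB1
    linarith
  · have : 0 < 1 / B := by positivity
    linarith
  · intro s hs a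
    have h1 : w s * (1 / B) ≤ 1 := by
      rw [mul_one_div, div_le_one hB0]; exact hwB s
    have h2 : 0 ≤ ∑ s', P.trans s a s' * w s' :=
      Finset.sum_nonneg fun s' _ => mul_nonneg (P.trans_nonneg _ _ _) (hw0 s')
    have h3 := mul_le_of_le_one_left h2 P.γ_le_one
    have h4 := hdec s hs a
    linarith

end Running

theorem exists_contractingWeight [Fintype A] [Nonempty A] (P : POMDP S O A R)
    (hγ : P.γ < 1 ∨ P.EpisodesEnd) : ∃ w ρ, P.ContractingWeight w ρ := by
  rcases hγ with hγ | hP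
  · exact ⟨fun _ => 1, P.γ, P.γ_nonneg, hγ, fun _ => zero_le_one, fun _ _ => le_rfl,
      fun s _ a => by simp [P.sum_trans s a]⟩
  · exact hP.exists_contractingWeight

theorem returnFrom_terminal [Fintype A] (P : POMDP S O A R) (π : HistoryPolicy O A) (n : ℕ)
    (h : History O A) {s : S} (hs : s ∈ P.terminal) : P.returnFrom π n h s = 0 := by
  cases n <;> simp [returnFrom, hs]

theorem sum_p_mul (P : POMDP S O A R) (s : S) (a : A) (f : S → ℝ) :
    ∑ x : S × R, P.p s a x * f x.1 = ∑ s', P.trans s a s' * f s' := by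
  rw [Fintype.sum_prod_type]
  exact Finset.sum_congr rfl fun s' _ => by rw [trans, Finset.sum_mul]

theorem returnFrom_succ [Fintype A] (P : POMDP S O A R) (π : HistoryPolicy O A) (n : ℕ)
    (h : History O A) {s : S} (hs : s ∉ P.terminal) :
    P.returnFrom π (n + 1) h s = ∑ a, π h a * (P.reward s a +
      P.γ * ∑ s', P.trans s a s' * ∑ o, P.ω s' o * P.returnFrom π n (h.step a o) s') := by
  simp only [returnFrom, hs, if_false]
  refine Finset.sum_congr rfl fun a _ => ?_
  rw [← P.sum_p_mul s a fun s' => ∑ o, P.ω s' o * P.returnFrom π n (h.step a o) s',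
    reward]
  congr 1
  rw [Finset.mul_sum, ← Finset.sum_add_distrib]
  exact Finset.sum_congr rfl fun x _ => by ring

/-! ### Geometric convergence of truncated returns. -/

section Convergence

variable {P : POMDP S O A R} {w : S → ℝ} {ρ : ℝ}

/-- The factor in the error bounds of the finite-horizon values. -/
noncomputable def errorFactor (P : POMDP S O A R) (ρ : ℝ) : ℝ := P.rewardBound / (1 - ρ)

theorem ContractingWeight.errorFactor_nonneg (hw : P.ContractingWeight w ρ) :
    0 ≤ P.errorFactor ρ :=
  div_nonneg P.rewardBound_nonneg (by linarith [hw.rate_lt_one])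

/-- This fixed-point identity makes the bound `errorFactor * w` reproduce itself under one step of
the return recursion. -/
theorem ContractingWeight.rewardBound_add (hw : P.ContractingWeight w ρ) :
    P.rewardBound + ρ * P.errorFactor ρ = P.errorFactor ρ := by
  have : 1 - ρ ≠ 0 := by linarith [hw.rate_lt_one]
  rw [errorFactor]
  field_simp
  ring

theorem ContractingWeight.abs_returnFrom_le [Fintype A] (hw : P.ContractingWeight w ρ)
    (π : HistoryPolicy O A) (n : ℕ) (h : History O A) (s : S) :
    |P.returnFrom π n h s| ≤ P.errorFactor ρ * w s := by
  have hC := hw.errorFactor_nonneg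
  induction n generalizing h s with
  | zero => simpa [returnFrom] using mul_nonneg hC (hw.nonneg s)
  | succ n ih =>
    by_cases hs : s ∈ P.terminal
    · rw [returnFrom_terminal P π _ h hs, abs_zero]
      exact mul_nonneg hC (hw.nonneg s)
    · rw [returnFrom_succ P π n h hs]
      refine stdSimplex.abs_sum_mul_le _ fun a => (abs_add_le _ _).trans ?_
      have h1 : |∑ s', P.trans s a s' * ∑ o, P.ω s' o * P.returnFrom π n (h.step a o) s'| ≤
          ∑ s', P.trans s a s' * (P.errorFactor ρ * w s') := by
        refine (Finset.abs_sum_le_sum_abs _ _).trans (Finset.sum_le_sum fun s' _ => ?_)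
        rw [abs_mul, abs_of_nonneg (P.trans_nonneg _ _ _)]
        exact mul_le_mul_of_nonneg_left (stdSimplex.abs_sum_mul_le _ fun _ => ih _ _)
          (P.trans_nonneg _ _ _)
      have h2 : P.γ * ∑ s', P.trans s a s' * (P.errorFactor ρ * w s') ≤
          P.errorFactor ρ * (ρ * w s) := by
        refine le_trans (le_of_eq ?_) (mul_le_mul_of_nonneg_left (hw.contract s hs a) hC)
        simp_rw [Finset.mul_sum]
        exact Finset.sum_congr rfl fun _ _ => by ring
      rw [abs_mul, abs_of_nonneg P.γ_nonneg]
      have h3 := mul_le_mul_of_nonneg_left h1 P.γ_nonneg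
      have h4 := P.abs_reward_le s a
      have h5 := le_mul_of_one_le_right P.rewardBound_nonneg (hw.one_le s hs)
      have h6 := hw.rewardBound_add
      calc |P.reward s a| + _ ≤ P.rewardBound * w s + P.errorFactor ρ * (ρ * w s) := by linarith
        _ = (P.rewardBound + ρ * P.errorFactor ρ) * w s := by ring
        _ = _ := by rw [h6]

/-- The two truncations share their first `n` rewards. What is left is a return from time `n` on,
bounded by `errorFactor * w` and contracted `n` times. -/
theorem ContractingWeight.abs_returnFrom_sub_le [Fintype A] (hw : P.ContractingWeight w ρ)
    (π : HistoryPolicy O A) (n k : ℕ) (h : History O A) (s : S) :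
    |P.returnFrom π (n + k) h s - P.returnFrom π n h s| ≤ P.errorFactor ρ * ρ ^ n * w s := by
  have hC := hw.errorFactor_nonneg
  have hρ := hw.rate_nonneg
  induction n generalizing h s with
  | zero => simpa [returnFrom] using hw.abs_returnFrom_le π k h s
  | succ n ih =>
    by_cases hs : s ∈ P.terminal
    · rw [returnFrom_terminal P π _ h hs, returnFrom_terminal P π _ h hs, sub_zero, abs_zero]
      exact mul_nonneg (mul_nonneg hC (pow_nonneg hρ _)) (hw.nonneg s)
    · rw [Nat.add_right_comm, returnFrom_succ P π _ h hs, returnFrom_succ P π _ h hs,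
        ← Finset.sum_sub_distrib]
      simp_rw [← mul_sub, add_sub_add_left_eq_sub, ← mul_sub, ← Finset.sum_sub_distrib, ← mul_sub,
        ← Finset.sum_sub_distrib, ← mul_sub]
      refine stdSimplex.abs_sum_mul_le _ fun a => ?_
      rw [abs_mul, abs_of_nonneg P.γ_nonneg]
      have h1 : |∑ s', P.trans s a s' * ∑ o, P.ω s' o *
          (P.returnFrom π (n + k) (h.step a o) s' - P.returnFrom π n (h.step a o) s')| ≤
          ∑ s', P.trans s a s' * (P.errorFactor ρ * ρ ^ n * w s') := by
        refine (Finset.abs_sum_le_sum_abs _ _).trans (Finset.sum_le_sum fun s' _ => ?_)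
        rw [abs_mul, abs_of_nonneg (P.trans_nonneg _ _ _)]
        exact mul_le_mul_of_nonneg_left (stdSimplex.abs_sum_mul_le _ fun _ => ih _ _)
          (P.trans_nonneg _ _ _)
      calc _ ≤ P.γ * ∑ s', P.trans s a s' * (P.errorFactor ρ * ρ ^ n * w s') :=
            mul_le_mul_of_nonneg_left h1 P.γ_nonneg
        _ = P.errorFactor ρ * ρ ^ n * (P.γ * ∑ s', P.trans s a s' * w s') := by
            simp_rw [Finset.mul_sum]
            exact Finset.sum_congr rfl fun _ _ => by ring
        _ ≤ P.errorFactor ρ * ρ ^ n * (ρ * w s) :=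
            mul_le_mul_of_nonneg_left (hw.contract s hs a) (mul_nonneg hC (pow_nonneg hρ _))
        _ = _ := by ring

/-- The weight of the initial distribution. -/
noncomputable def initialWeight (P : POMDP S O A R) (w : S → ℝ) : ℝ := ∑ s, P.μ s * w s

theorem ContractingWeight.abs_returnUpTo_sub_le [Fintype A] (hw : P.ContractingWeight w ρ)
    (π : HistoryPolicy O A) (n k : ℕ) :
    |P.returnUpTo π (n + k) - P.returnUpTo π n| ≤
      P.errorFactor ρ * ρ ^ n * P.initialWeight w := by
  simp_rw [returnUpTo, ← Finset.sum_sub_distrib, ← mul_sub, ← Finset.sum_sub_distrib, ← mul_sub]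
  refine (Finset.abs_sum_le_sum_abs _ _).trans ?_
  rw [initialWeight, Finset.mul_sum]
  refine Finset.sum_le_sum fun s _ => ?_
  rw [abs_mul, abs_of_nonneg (stdSimplex.zero_le _ _), mul_left_comm]
  exact mul_le_mul_of_nonneg_left
    (stdSimplex.abs_sum_mul_le _ fun _ => hw.abs_returnFrom_sub_le π n k _ s)
    (stdSimplex.zero_le _ _)

theorem ContractingWeight.tendsto_error (hw : P.ContractingWeight w ρ) (c : ℝ) :
    Tendsto (fun n : ℕ => P.errorFactor ρ * ρ ^ n * c) atTop (𝓝 0) := by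
  simpa using ((tendsto_pow_atTop_nhds_zero_of_lt_one hw.rate_nonneg hw.rate_lt_one).const_mul
    (P.errorFactor ρ)).mul_const c

end Convergence

end General

end POMDP

/-! ### Existence of values, and an optimal memoryless policy by compactness. -/

theorem exists_tendsto_of_abs_sub_le {u ε : ℕ → ℝ} (hε : Tendsto ε atTop (𝓝 0))
    (h : ∀ n k, |u (n + k) - u n| ≤ ε n) : ∃ v, Tendsto u atTop (𝓝 v) := by
  refine cauchySeq_tendsto_of_complete (Metric.cauchySeq_iff'.2 fun e he => ?_)
  obtain ⟨N, hN⟩ := (hε.eventually_lt_const he).exists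
  refine ⟨N, fun n hn => ?_⟩
  obtain ⟨k, rfl⟩ := Nat.exists_eq_add_of_le hn
  rw [Real.dist_eq]
  exact (h N k).trans_lt hN

theorem abs_sub_le_of_tendsto {u ε : ℕ → ℝ} {v : ℝ} (hu : Tendsto u atTop (𝓝 v))
    (h : ∀ n k, |u (n + k) - u n| ≤ ε n) (n : ℕ) : |v - u n| ≤ ε n := by
  have h1 : Tendsto (fun k => u (n + k)) atTop (𝓝 v) := by
    simpa only [add_comm n] using (tendsto_add_atTop_iff_nat n).2 hu
  exact le_of_tendsto' (h1.sub_const _).abs (h n)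

namespace POMDP

section Optimality

variable {S O A : Type*} {R : Finset ℝ} [Fintype S] [Fintype O] [Fintype A]
  {P : POMDP S O A R} {w : S → ℝ} {ρ : ℝ}

theorem ContractingWeight.exists_hasValue (hw : P.ContractingWeight w ρ)
    (π : HistoryPolicy O A) : ∃ v, P.HasValue π v :=
  exists_tendsto_of_abs_sub_le (hw.tendsto_error _) (hw.abs_returnUpTo_sub_le π)

theorem continuous_returnFrom (P : POMDP S O A R) (n : ℕ) (h : History O A) (s : S) :
    Continuous fun π : HistoryPolicy O A => P.returnFrom π n h s := by
  induction n generalizing h s with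
  | zero => simpa only [returnFrom] using continuous_const
  | succ n ih =>
    by_cases hs : s ∈ P.terminal
    · simpa only [returnFrom_terminal P _ _ h hs] using continuous_const
    · simp_rw [returnFrom_succ P _ _ h hs]
      refine continuous_finsetSum _ fun a _ => Continuous.mul ?_ ?_
      · exact (continuous_apply a).comp (continuous_subtype_val.comp (continuous_apply h))
      · exact continuous_const.add (continuous_const.mul (continuous_finsetSum _ fun s' _ =>
          continuous_const.mul (continuous_finsetSum _ fun _ _ =>
            continuous_const.mul (ih _ _))))

theorem continuous_returnUpTo (P : POMDP S O A R) (n : ℕ) :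
    Continuous fun π : HistoryPolicy O A => P.returnUpTo π n :=
  continuous_finsetSum _ fun s _ => continuous_const.mul (continuous_finsetSum _ fun _ _ =>
    continuous_const.mul (P.continuous_returnFrom n _ s))

/-- The error bound does not depend on the policy, so the value is a uniform limit of continuous
functions. It attains its maximum on the compact product of simplices formed by the memoryless
policies. -/
theorem ContractingWeight.exists_isOptimalMemoryless [Nonempty A] (hw : P.ContractingWeight w ρ) :
    ∃ π : MemorylessPolicy O A, P.IsOptimalMemoryless π := by
  choose V hV using hw.exists_hasValue
  have hunif : TendstoUniformly (fun n π => P.returnUpTo π n) V atTop := by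
    rw [Metric.tendstoUniformly_iff]
    intro e he
    filter_upwards [(hw.tendsto_error (P.initialWeight w)).eventually_lt_const he] with n hn π
    rw [Real.dist_eq]
    exact (abs_sub_le_of_tendsto (hV π) (hw.abs_returnUpTo_sub_le π) n).trans_lt hn
  have hcont : Continuous V :=
    hunif.continuous (Frequently.of_forall fun n => P.continuous_returnUpTo n)
  have hmem : Continuous fun π : MemorylessPolicy O A => V π.toHistory :=
    hcont.comp (continuous_pi fun h => continuous_apply h.last)
  obtain ⟨π, -, hπ⟩ := isCompact_univ.exists_isMaxOn Set.univ_nonempty hmem.continuousOn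
  refine ⟨π, V π.toHistory, hV _, fun π' v' hv' => ?_⟩
  rw [tendsto_nhds_unique hv' (hV _)]
  exact hπ (Set.mem_univ π')

end Optimality

end POMDP

/-! ### Unnormalised beliefs and one step of filtering. -/

namespace POMDP

section Beliefs

variable {S O A : Type*} {R : Finset ℝ} [Fintype S] [Fintype O]
  {P : POMDP S O A R} {w : S → ℝ} {ρ : ℝ}

/-- Nonnegative weights on the non-terminal states. -/
structure IsRunningWeight (P : POMDP S O A R) (v : S → ℝ) : Prop where
  nonneg : ∀ s, 0 ≤ v s
  terminal : ∀ s ∈ P.terminal, v s = 0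

theorem isRunningWeight_init (P : POMDP S O A R) (o : O) : P.IsRunningWeight (P.init o) where
  nonneg s := by
    simp only [init]
    split_ifs
    · exact le_rfl
    · exact mul_nonneg (stdSimplex.zero_le _ _) (stdSimplex.zero_le _ _)
  terminal s hs := by simp [init, hs]

theorem IsRunningWeight.update {v : S → ℝ} (hv : P.IsRunningWeight v) (a : A) (o : O) :
    P.IsRunningWeight (P.update v a o) where
  nonneg s := by
    simp only [POMDP.update]
    split_ifs
    · exact le_rfl
    · exact mul_nonneg (stdSimplex.zero_le _ _)
        (Finset.sum_nonneg fun s _ => mul_nonneg (P.trans_nonneg _ _ _) (hv.nonneg s))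
  terminal s hs := by simp [POMDP.update, hs]

theorem IsRunningWeight.smul {v : S → ℝ} (hv : P.IsRunningWeight v) {c : ℝ} (hc : 0 ≤ c) :
    P.IsRunningWeight (c • v) where
  nonneg s := mul_nonneg hc (hv.nonneg s)
  terminal s hs := by simp [hv.terminal s hs]

theorem isRunningWeight_forward (P : POMDP S O A R) (h : History O A) :
    P.IsRunningWeight (P.forward h) := by
  induction h with
  | start o => exact P.isRunningWeight_init o
  | step h a o ih => exact ih.update a o

theorem update_smul (P : POMDP S O A R) (c : ℝ) (v : S → ℝ) (a : A) (o : O) :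
    P.update (c • v) a o = c • P.update v a o := by
  funext s
  simp only [POMDP.update, Pi.smul_apply, smul_eq_mul]
  split_ifs
  · simp
  · simp_rw [Finset.mul_sum]
    exact Finset.sum_congr rfl fun _ _ => by ring

/-- Total weight zero is harmless: nonnegativity then makes `v` vanish, so the junk value of the
division does not matter. -/
theorem IsRunningWeight.eq_sum_smul_div {v : S → ℝ} (hv : P.IsRunningWeight v) :
    v = (∑ x, v x) • fun s => v s / ∑ x, v x := by
  funext s
  by_cases h : ∑ x, v x = 0
  · have := (Finset.sum_eq_zero_iff_of_nonneg fun x _ => hv.nonneg x).1 h s (Finset.mem_univ s)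
    simp [this]
  · simp only [Pi.smul_apply, smul_eq_mul]
    field_simp

theorem isRunningWeight_belief (P : POMDP S O A R) (h : History O A) :
    P.IsRunningWeight (P.belief h) := by
  have key : ∀ v : S → ℝ, P.IsRunningWeight v → P.IsRunningWeight fun s => v s / ∑ x, v x :=
    fun v hv => ⟨fun s => div_nonneg (hv.nonneg s) (Finset.sum_nonneg fun x _ => hv.nonneg x),
      fun s hs => by simp [hv.terminal s hs]⟩
  induction h with
  | start o => exact key _ (P.isRunningWeight_init o)
  | step h a o ih => exact key _ (ih.update a o)

/-- The belief state is the normalisation of the forward probabilities. -/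
theorem exists_forward_eq_smul_belief (P : POMDP S O A R) (h : History O A) :
    ∃ c : ℝ, 0 ≤ c ∧ P.forward h = c • P.belief h := by
  induction h with
  | start o =>
    have hv := P.isRunningWeight_init o
    exact ⟨_, Finset.sum_nonneg fun x _ => hv.nonneg x, hv.eq_sum_smul_div⟩
  | step h a o ih =>
    obtain ⟨c, hc, hb⟩ := ih
    have hv := (P.isRunningWeight_belief h).update a o
    refine ⟨c * ∑ x, P.update (P.belief h) a o x,
      mul_nonneg hc (Finset.sum_nonneg fun x _ => hv.nonneg x), ?_⟩
    rw [mul_smul]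
    change P.update (P.forward h) a o = c • (∑ x, P.update (P.belief h) a o x) •
      fun s => P.update (P.belief h) a o s / ∑ x, P.update (P.belief h) a o x
    rw [← hv.eq_sum_smul_div, hb, update_smul]

/-- Filtering forward is adjoint to taking expectations backward. Since `update` discards terminal
states, `g` has to vanish on them. -/
theorem sum_mul_update (P : POMDP S O A R) {g : O → S → ℝ}
    (hg : ∀ o, ∀ s ∈ P.terminal, g o s = 0) (v : S → ℝ) (a : A) :
    ∑ o, ∑ s', P.update v a o s' * g o s' =
      ∑ s, v s * ∑ s', P.trans s a s' * ∑ o, P.ω s' o * g o s' := by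
  have h1 : ∀ o s', P.update v a o s' * g o s' =
      ∑ s, v s * (P.trans s a s' * (P.ω s' o * g o s')) := by
    intro o s'
    by_cases hs : s' ∈ P.terminal
    · simp [hg o s' hs]
    · simp only [POMDP.update, hs, if_false]
      rw [mul_right_comm, Finset.mul_sum]
      exact Finset.sum_congr rfl fun _ _ => by ring
  simp_rw [h1, Finset.mul_sum]
  rw [Finset.sum_comm, Finset.sum_comm_cycle]

/-- One discounted filtering step contracts the total weight. -/
theorem ContractingWeight.sum_update_le (hw : P.ContractingWeight w ρ) {v : S → ℝ}
    (hv : P.IsRunningWeight v) (a : A) :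
    P.γ * ∑ o, ∑ s', P.update v a o s' * w s' ≤ ρ * ∑ s, v s * w s := by
  classical
  -- The weight `w` may be positive at terminal states; it is cut off there so that `sum_mul_update`
  -- applies.
  have h1 : ∀ o s', P.update v a o s' * w s' =
      P.update v a o s' * (if s' ∈ P.terminal then 0 else w s') := by
    intro o s'
    split_ifs with hs
    · simp [(hv.update a o).terminal s' hs]
    · rfl
  simp_rw [h1]
  rw [P.sum_mul_update (g := fun _ s' => if s' ∈ P.terminal then 0 else w s')
    (fun o s hs => by simp [hs]), Finset.mul_sum, Finset.mul_sum]
  refine Finset.sum_le_sum fun s _ => ?_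
  by_cases hs : s ∈ P.terminal
  · simp [hv.terminal s hs]
  rw [mul_left_comm, mul_left_comm ρ]
  refine mul_le_mul_of_nonneg_left (le_trans ?_ (hw.contract s hs a)) (hv.nonneg s)
  refine mul_le_mul_of_nonneg_left (Finset.sum_le_sum fun s' _ =>
    mul_le_mul_of_nonneg_left (stdSimplex.sum_mul_le _ fun o => ?_) (P.trans_nonneg _ _ _))
    P.γ_nonneg
  split_ifs
  · exact hw.nonneg s'
  · exact le_rfl

theorem ContractingWeight.abs_sum_reward_le (hw : P.ContractingWeight w ρ) {v : S → ℝ}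
    (hv : P.IsRunningWeight v) (a : A) :
    |∑ s, v s * P.reward s a| ≤ P.rewardBound * ∑ s, v s * w s := by
  refine (Finset.abs_sum_le_sum_abs _ _).trans ?_
  rw [Finset.mul_sum]
  refine Finset.sum_le_sum fun s _ => ?_
  rw [abs_mul, abs_of_nonneg (hv.nonneg s), mul_left_comm]
  by_cases hs : s ∈ P.terminal
  · simp [hv.terminal s hs]
  · exact mul_le_mul_of_nonneg_left ((P.abs_reward_le s a).trans
      (le_mul_of_one_le_right P.rewardBound_nonneg (hw.one_le s hs))) (hv.nonneg s)

/-- The value of the action `a` under the weights `v`, if `u` is the value of the weights after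
the next observation. -/
noncomputable def actionValue (P : POMDP S O A R) (u : (S → ℝ) → ℝ) (v : S → ℝ) (a : A) : ℝ :=
  ∑ s, v s * P.reward s a + P.γ * ∑ o, u (P.update v a o)

theorem actionValue_smul (P : POMDP S O A R) {u : (S → ℝ) → ℝ} {c : ℝ} {v : S → ℝ} {a : A}
    (hu : ∀ o, u (c • P.update v a o) = c * u (P.update v a o)) :
    P.actionValue u (c • v) a = c * P.actionValue u v a := by
  simp only [actionValue, update_smul, hu, Pi.smul_apply, smul_eq_mul, mul_assoc,
    ← Finset.mul_sum]
  ring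

theorem ContractingWeight.abs_actionValue_sub_le (hw : P.ContractingWeight w ρ)
    {u₁ u₂ : (S → ℝ) → ℝ} {c : ℝ} (hc : 0 ≤ c)
    (hu : ∀ v, P.IsRunningWeight v → |u₁ v - u₂ v| ≤ c * ∑ s, v s * w s) {v : S → ℝ}
    (hv : P.IsRunningWeight v) (a : A) :
    |P.actionValue u₁ v a - P.actionValue u₂ v a| ≤ c * ρ * ∑ s, v s * w s := by
  rw [actionValue, actionValue, add_sub_add_left_eq_sub, ← mul_sub, ← Finset.sum_sub_distrib,
    abs_mul, abs_of_nonneg P.γ_nonneg]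
  have h1 : |∑ o, (u₁ (P.update v a o) - u₂ (P.update v a o))| ≤
      c * ∑ o, ∑ s, P.update v a o s * w s := by
    refine (Finset.abs_sum_le_sum_abs _ _).trans ?_
    rw [Finset.mul_sum]
    exact Finset.sum_le_sum fun o _ => hu _ (hv.update a o)
  calc _ ≤ P.γ * (c * ∑ o, ∑ s, P.update v a o s * w s) :=
        mul_le_mul_of_nonneg_left h1 P.γ_nonneg
    _ = c * (P.γ * ∑ o, ∑ s, P.update v a o s * w s) := by ring
    _ ≤ c * (ρ * ∑ s, v s * w s) := mul_le_mul_of_nonneg_left (hw.sum_update_le hv a) hc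
    _ = _ := by ring

end Beliefs

/-! ### Dynamic programming on beliefs and the greedy policy. -/

section Optimal

variable {S O A : Type*} {R : Finset ℝ} [Fintype S] [Fintype O] [Fintype A]
  {P : POMDP S O A R} {w : S → ℝ} {ρ : ℝ}

/-- The expected return of `π` over the next `n` steps on the event that the history is `h`. -/
noncomputable def expectedReturn (P : POMDP S O A R) (π : HistoryPolicy O A) (n : ℕ)
    (h : History O A) : ℝ :=
  ∑ s, P.forward h s * P.returnFrom π n h s

theorem returnUpTo_eq_sum_expectedReturn (P : POMDP S O A R) (π : HistoryPolicy O A) (n : ℕ) :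
    P.returnUpTo π n = ∑ o, P.expectedReturn π n (.start o) := by
  simp_rw [returnUpTo, expectedReturn, Finset.mul_sum]
  rw [Finset.sum_comm]
  refine Finset.sum_congr rfl fun o _ => Finset.sum_congr rfl fun s _ => ?_
  by_cases hs : s ∈ P.terminal
  · simp [returnFrom_terminal P _ _ _ hs]
  · simp [forward, init, hs, mul_assoc]

theorem expectedReturn_succ (P : POMDP S O A R) (π : HistoryPolicy O A) (n : ℕ)
    (h : History O A) :
    P.expectedReturn π (n + 1) h = ∑ a, π h a * (∑ s, P.forward h s * P.reward s a +
      P.γ * ∑ o, P.expectedReturn π n (h.step a o)) := by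
  have h1 : ∀ s, P.forward h s * P.returnFrom π (n + 1) h s = ∑ a, π h a *
      (P.forward h s * P.reward s a + P.γ * (P.forward h s *
        ∑ s', P.trans s a s' * ∑ o, P.ω s' o * P.returnFrom π n (h.step a o) s')) := by
    intro s
    by_cases hs : s ∈ P.terminal
    · simp [(P.isRunningWeight_forward h).terminal s hs]
    · rw [returnFrom_succ P π n h hs, Finset.mul_sum]
      exact Finset.sum_congr rfl fun a _ => by ring
  rw [expectedReturn, Finset.sum_congr rfl fun s _ => h1 s, Finset.sum_comm]
  refine Finset.sum_congr rfl fun a _ => ?_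
  rw [← Finset.mul_sum, Finset.sum_add_distrib, ← Finset.mul_sum,
    ← P.sum_mul_update (g := fun o s' => P.returnFrom π n (h.step a o) s')
      fun o s hs => returnFrom_terminal P _ _ _ hs]
  rfl

variable [Nonempty A]

/-- The optimal expected return over the next `n` steps for unnormalised beliefs. -/
noncomputable def optimalReturn (P : POMDP S O A R) : ℕ → (S → ℝ) → ℝ
  | 0, _ => 0
  | n + 1, v => Finset.univ.sup' Finset.univ_nonempty (P.actionValue (P.optimalReturn n) v)

theorem actionValue_le_optimalReturn (P : POMDP S O A R) (n : ℕ) (v : S → ℝ) (a : A) :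
    P.actionValue (P.optimalReturn n) v a ≤ P.optimalReturn (n + 1) v :=
  Finset.le_sup' _ (Finset.mem_univ a)

/-- Filtering is linear, and a maximum commutes with nonnegative scaling. Hence optimal decisions do
not depend on the normalisation of the belief. -/
theorem optimalReturn_smul (P : POMDP S O A R) (n : ℕ) {c : ℝ} (hc : 0 ≤ c) (v : S → ℝ) :
    P.optimalReturn n (c • v) = c * P.optimalReturn n v := by
  induction n generalizing v with
  | zero => simp [optimalReturn]
  | succ n ih =>
    simp only [optimalReturn]
    rw [Finset.mul₀_sup' hc]
    exact Finset.sup'_congr _ rfl fun a _ => P.actionValue_smul fun o => ih _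

theorem abs_sup'_sub_le {ι : Type*} {s : Finset ι} (hs : s.Nonempty) {f g : ι → ℝ} {c : ℝ}
    (h : ∀ i ∈ s, |f i - g i| ≤ c) : |s.sup' hs f - s.sup' hs g| ≤ c := by
  rw [abs_sub_le_iff, sub_le_iff_le_add, sub_le_iff_le_add]
  refine ⟨Finset.sup'_le _ _ fun i hi => ?_, Finset.sup'_le _ _ fun i hi => ?_⟩
  · have := (abs_sub_le_iff.1 (h i hi)).1
    have := Finset.le_sup' g hi
    linarith
  · have := (abs_sub_le_iff.1 (h i hi)).2
    have := Finset.le_sup' f hi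
    linarith

theorem ContractingWeight.abs_optimalReturn_le (hw : P.ContractingWeight w ρ) (n : ℕ)
    {v : S → ℝ} (hv : P.IsRunningWeight v) :
    |P.optimalReturn n v| ≤ P.errorFactor ρ * ∑ s, v s * w s := by
  have hC := hw.errorFactor_nonneg
  induction n generalizing v with
  | zero =>
    simpa [optimalReturn] using mul_nonneg hC
      (Finset.sum_nonneg fun s _ => mul_nonneg (hv.nonneg s) (hw.nonneg s))
  | succ n ih =>
    -- Writing `0` as a maximum of zeros reduces the bound to a comparison of maxima, action by
    -- action.
    have h0 : (Finset.univ.sup' Finset.univ_nonempty fun _ : A => (0 : ℝ)) = 0 :=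
      Finset.sup'_const _ _
    rw [← sub_zero (P.optimalReturn (n + 1) v), ← h0]
    refine abs_sup'_sub_le _ fun a _ => ?_
    have h1 := hw.abs_actionValue_sub_le (u₁ := P.optimalReturn n) (u₂ := 0) hC
      (fun v hv => by simpa using ih hv) hv a
    have h2 := hw.abs_sum_reward_le hv a
    have h3 : P.actionValue 0 v a = ∑ s, v s * P.reward s a := by simp [actionValue]
    rw [← h3] at h2
    have h4 : P.actionValue (P.optimalReturn n) v a - 0 =
      (P.actionValue (P.optimalReturn n) v a - P.actionValue 0 v a) + P.actionValue 0 v a := by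
      ring
    rw [h4]
    refine (abs_add_le _ _).trans ((add_le_add h1 h2).trans_eq ?_)
    rw [← add_mul]
    congr 1
    linarith [hw.rewardBound_add]

theorem ContractingWeight.abs_optimalReturn_sub_le (hw : P.ContractingWeight w ρ) (n k : ℕ)
    {v : S → ℝ} (hv : P.IsRunningWeight v) :
    |P.optimalReturn (n + k) v - P.optimalReturn n v| ≤
      P.errorFactor ρ * ρ ^ n * ∑ s, v s * w s := by
  induction n generalizing v with
  | zero => simpa [optimalReturn] using hw.abs_optimalReturn_le k hv
  | succ n ih =>
    rw [Nat.add_right_comm]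
    refine abs_sup'_sub_le _ fun a _ => ?_
    rw [pow_succ, ← mul_assoc]
    exact hw.abs_actionValue_sub_le
      (mul_nonneg hw.errorFactor_nonneg (pow_nonneg hw.rate_nonneg _)) (fun v hv => ih hv) hv a

/-- Backward induction: the average over the actions of `π` is at most the maximum over actions. -/
theorem expectedReturn_le_optimalReturn (P : POMDP S O A R) (π : HistoryPolicy O A) (n : ℕ)
    (h : History O A) : P.expectedReturn π n h ≤ P.optimalReturn n (P.forward h) := by
  induction n generalizing h with
  | zero => simp [expectedReturn, returnFrom, optimalReturn]
  | succ n ih =>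
    rw [expectedReturn_succ]
    refine stdSimplex.sum_mul_le _ fun a =>
      le_trans ?_ (P.actionValue_le_optimalReturn n (P.forward h) a)
    exact add_le_add le_rfl (mul_le_mul_of_nonneg_left (Finset.sum_le_sum fun o _ => ih _)
      P.γ_nonneg)

/-- The optimal expected return over the first `n` steps. -/
noncomputable def optimalReturnUpTo (P : POMDP S O A R) (n : ℕ) : ℝ :=
  ∑ o, P.optimalReturn n (P.init o)

theorem returnUpTo_le_optimalReturnUpTo (P : POMDP S O A R) (π : HistoryPolicy O A) (n : ℕ) :
    P.returnUpTo π n ≤ P.optimalReturnUpTo n := by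
  rw [returnUpTo_eq_sum_expectedReturn]
  exact Finset.sum_le_sum fun o _ => P.expectedReturn_le_optimalReturn π n (.start o)

open Classical in
/-- The deterministic policy that chooses its actions from the belief state. -/
noncomputable def beliefPolicy (P : POMDP S O A R) (act : (S → ℝ) → A) : HistoryPolicy O A :=
  fun h => stdSimplex.vertex (act (P.belief h))

/-- The limit `U` of the finite-horizon optima solves the Bellman equation. Following its maximising
actions loses nothing in any step, so the truncated return differs from `U` only by the contracted
tail. -/
theorem ContractingWeight.exists_optimal_beliefPolicy (hw : P.ContractingWeight w ρ) :
    ∃ (act : (S → ℝ) → A) (V : ℝ), P.HasValue (P.beliefPolicy act) V ∧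
      Tendsto P.optimalReturnUpTo atTop (𝓝 V) := by
  -- The limit is only known for running weights; elsewhere `U` gets the irrelevant value `0`, which
  -- keeps it a total function.
  have hlim : ∀ v, ∃ l, P.IsRunningWeight v →
      Tendsto (fun n => P.optimalReturn n v) atTop (𝓝 l) := by
    intro v
    by_cases hv : P.IsRunningWeight v
    · obtain ⟨l, hl⟩ := exists_tendsto_of_abs_sub_le (u := fun n => P.optimalReturn n v)
        (hw.tendsto_error (∑ s, v s * w s)) fun n k => hw.abs_optimalReturn_sub_le n k hv
      exact ⟨l, fun _ => hl⟩
    · exact ⟨0, fun h => absurd h hv⟩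
  choose U hU using hlim
  have hbell : ∀ v, P.IsRunningWeight v →
      U v = Finset.univ.sup' Finset.univ_nonempty (P.actionValue U v) := by
    intro v hv
    refine tendsto_nhds_unique ((tendsto_add_atTop_iff_nat 1).2 (hU v hv)) ?_
    exact Tendsto.finset_sup'_nhds_apply Finset.univ_nonempty fun a _ =>
      tendsto_const_nhds.add ((tendsto_finsetSum _ fun o _ => hU _ (hv.update a o)).const_mul _)
  have hhom : ∀ c, 0 ≤ c → ∀ v, P.IsRunningWeight v → U (c • v) = c * U v := by
    intro c hc v hv
    refine tendsto_nhds_unique (hU _ (hv.smul hc)) ?_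
    simp_rw [P.optimalReturn_smul _ hc]
    exact (hU v hv).const_mul c
  have hmax : ∀ v, ∃ a, ∀ a', P.actionValue U v a' ≤ P.actionValue U v a :=
    fun v => Finite.exists_max (P.actionValue U v)
  choose act hact using hmax
  -- The action is chosen at the normalised belief but used at the forward weights. Both sides scale
  -- by the same `c ≥ 0`, possibly `0` for impossible histories.
  have hgreedy : ∀ h, U (P.forward h) = P.actionValue U (P.forward h) (act (P.belief h)) := by
    intro h
    have hb := P.isRunningWeight_belief h
    obtain ⟨c, hc, hcb⟩ := P.exists_forward_eq_smul_belief h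
    have h1 : U (P.belief h) = P.actionValue U (P.belief h) (act (P.belief h)) := by
      rw [hbell _ hb]
      exact le_antisymm (Finset.sup'_le _ _ fun a _ => hact _ a)
        (Finset.le_sup' (P.actionValue U (P.belief h)) (Finset.mem_univ _))
    rw [hcb, hhom c hc _ hb, P.actionValue_smul fun o => hhom c hc _ (hb.update _ o), h1]
  have hclose : ∀ n h, |P.expectedReturn (P.beliefPolicy act) n h - U (P.forward h)| ≤
      P.errorFactor ρ * ρ ^ n * ∑ s, P.forward h s * w s := by
    intro n
    induction n with
    | zero =>
      intro h
      have hv := P.isRunningWeight_forward h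
      -- With no steps left the return is `0`, so the claim is the uniform bound on `optimalReturn`,
      -- passed to the limit.
      have h1 := le_of_tendsto' (hU _ hv).abs fun n => hw.abs_optimalReturn_le n hv
      simpa [expectedReturn, returnFrom] using h1
    | succ n ih =>
      intro h
      have hv := P.isRunningWeight_forward h
      set a := act (P.belief h) with ha
      have h1 : P.expectedReturn (P.beliefPolicy act) (n + 1) h =
          ∑ s, P.forward h s * P.reward s a +
            P.γ * ∑ o, P.expectedReturn (P.beliefPolicy act) n (h.step a o) := by
        rw [expectedReturn_succ, Finset.sum_eq_single a]
        · simp [beliefPolicy, ← ha]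
        · intro b _ hb
          simp [beliefPolicy, ← ha, hb]
        · simp
      rw [h1, hgreedy h, ← ha, actionValue, add_sub_add_left_eq_sub, ← mul_sub,
        ← Finset.sum_sub_distrib, abs_mul, abs_of_nonneg P.γ_nonneg]
      have hc := mul_nonneg hw.errorFactor_nonneg (pow_nonneg hw.rate_nonneg n)
      have h2 : |∑ o, (P.expectedReturn (P.beliefPolicy act) n (h.step a o) -
          U (P.update (P.forward h) a o))| ≤
          P.errorFactor ρ * ρ ^ n * ∑ o, ∑ s, P.update (P.forward h) a o s * w s := by
        refine (Finset.abs_sum_le_sum_abs _ _).trans ?_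
        rw [Finset.mul_sum]
        exact Finset.sum_le_sum fun o _ => ih (h.step a o)
      calc _ ≤ P.γ * (P.errorFactor ρ * ρ ^ n *
            ∑ o, ∑ s, P.update (P.forward h) a o s * w s) :=
            mul_le_mul_of_nonneg_left h2 P.γ_nonneg
        _ = P.errorFactor ρ * ρ ^ n *
            (P.γ * ∑ o, ∑ s, P.update (P.forward h) a o s * w s) := by ring
        _ ≤ P.errorFactor ρ * ρ ^ n * (ρ * ∑ s, P.forward h s * w s) :=
            mul_le_mul_of_nonneg_left (hw.sum_update_le hv a) hc
        _ = _ := by ring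
  refine ⟨act, ∑ o, U (P.init o), ?_, tendsto_finsetSum _ fun o _ =>
    hU _ (P.isRunningWeight_init o)⟩
  have hfun : P.returnUpTo (P.beliefPolicy act) =
      fun n => ∑ o, P.expectedReturn (P.beliefPolicy act) n (.start o) :=
    funext fun n => P.returnUpTo_eq_sum_expectedReturn _ n
  rw [HasValue, hfun]
  refine tendsto_finsetSum _ fun o _ => ?_
  rw [tendsto_iff_norm_sub_tendsto_zero]
  exact squeeze_zero (fun _ => norm_nonneg _) (fun n => hclose n (.start o)) (hw.tendsto_error _)

end Optimal

end POMDP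

/-! ### The memory-augmented environment and its projection. -/

theorem History.env_last {O A M W : Type*} (h : History (M × O) (A × W)) :
    h.env.last = h.last.2 := by
  cases h <;> rfl

namespace POMDP

section Augment

variable {S O A M W : Type*} {R : Finset ℝ} [Fintype S] [Fintype O] [Fintype M]
  {P : POMDP S O A R} {N : ExternalMemory O A R M W}

theorem augment_p (x : S × M × O) (b : A × W) (y : (S × M × O) × R) :
    (P.augment N).p x b y = P.p x.1 b.1 (y.1.1, y.2) *
      N.Γ x.2.1 b.2 x.2.2 b.1 y.2 y.1.2.2 y.1.2.1 * P.ω y.1.1 y.1.2.2 := rfl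

open Classical in
theorem augment_ω (x : S × M × O) (y : M × O) :
    (P.augment N).ω x y = if y = x.2 then 1 else 0 := rfl

theorem augment_μ (x : S × M × O) :
    (P.augment N).μ x = P.μ x.1 * N.η x.2.1 * P.ω x.1 x.2.2 := rfl

theorem augment_γ : (P.augment N).γ = P.γ := rfl

theorem mem_augment_terminal {x : S × M × O} :
    x ∈ (P.augment N).terminal ↔ x.1 ∈ P.terminal := Iff.rfl

/-- For functions that ignore the new memory state, `Γ` sums to one and disappears, whatever it
depends on. -/
theorem sum_augment_p_mul (x : S × M × O) (b : A × W) (f : S → R → O → ℝ) :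
    ∑ y, (P.augment N).p x b y * f y.1.1 y.2 y.1.2.2 =
      ∑ z : S × R, P.p x.1 b.1 z * ∑ o, P.ω z.1 o * f z.1 z.2 o := by
  have key : ∀ (s : S) (r : R), ∑ m : M, ∑ o : O, P.p x.1 b.1 (s, r) *
      N.Γ x.2.1 b.2 x.2.2 b.1 r o m * P.ω s o * f s r o =
      P.p x.1 b.1 (s, r) * ∑ o, P.ω s o * f s r o := by
    intro s r
    rw [Finset.sum_comm]
    simp_rw [← Finset.sum_mul, ← Finset.mul_sum, stdSimplex.sum_eq_one, mul_one, mul_assoc,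
      ← Finset.mul_sum]
  simp_rw [augment_p, Fintype.sum_prod_type]
  refine Finset.sum_congr rfl fun s _ => ?_
  simp_rw [← key]
  rw [Finset.sum_comm_cycle]

theorem augment_reward (x : S × M × O) (b : A × W) :
    (P.augment N).reward x b = P.reward x.1 b.1 := by
  have h := sum_augment_p_mul (P := P) (N := N) x b fun _ r _ => (r : ℝ)
  simp_rw [← Finset.sum_mul, stdSimplex.sum_eq_one, one_mul] at h
  exact h

theorem sum_augment_trans_mul (x : S × M × O) (b : A × W) (f : S → ℝ) :
    ∑ y, (P.augment N).trans x b y * f y.1 = ∑ s, P.trans x.1 b.1 s * f s := by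
  rw [← (P.augment N).sum_p_mul x b fun y => f y.1, ← P.sum_p_mul,
    sum_augment_p_mul x b fun s _ _ => f s]
  simp_rw [← Finset.sum_mul, stdSimplex.sum_eq_one, one_mul]

theorem ContractingWeight.augment {w : S → ℝ} {ρ : ℝ} (hw : P.ContractingWeight w ρ)
    (N : ExternalMemory O A R M W) :
    (P.augment N).ContractingWeight (fun x => w x.1) ρ where
  rate_nonneg := hw.rate_nonneg
  rate_lt_one := hw.rate_lt_one
  nonneg x := hw.nonneg x.1
  one_le x hx := hw.one_le x.1 hx
  contract x hx b := by
    rw [sum_augment_trans_mul]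
    exact hw.contract x.1 hx b.1

/-- Only supports are compared. The forward weights themselves need not factor through the projected
history, as the memory may have seen rewards correlated with the state. -/
theorem augment_forward_ne_zero {h : History (M × O) (A × W)} {x : S × M × O}
    (hx : (P.augment N).forward h x ≠ 0) :
    x.2 = h.last ∧ x.1 ∉ P.terminal ∧ 0 < P.ω x.1 x.2.2 ∧ 0 < P.forward h.env x.1 := by
  induction h generalizing x with
  | start z =>
    simp only [forward, init, augment_μ, augment_ω] at hx
    have hT : x.1 ∉ P.terminal := fun h => hx (if_pos h)
    rw [if_neg (mem_augment_terminal.not.2 hT)] at hx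
    have hz : z = x.2 := by
      by_contra h
      exact hx (by simp [h])
    subst hz
    simp only [if_true, mul_one] at hx
    have hω : P.ω x.1 x.2.2 ≠ 0 := right_ne_zero_of_mul hx
    have hμ : P.μ x.1 ≠ 0 := left_ne_zero_of_mul (left_ne_zero_of_mul hx)
    have hω' := (stdSimplex.zero_le (P.ω x.1) x.2.2).lt_of_ne' hω
    have hμ' := (stdSimplex.zero_le P.μ x.1).lt_of_ne' hμ
    refine ⟨rfl, hT, hω', ?_⟩
    simpa only [History.env, forward, init, hT, if_false] using mul_pos hμ' hω'
  | step h b z ih =>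
    simp only [forward, POMDP.update, augment_ω] at hx
    have hT : x.1 ∉ P.terminal := fun h => hx (if_pos h)
    rw [if_neg (mem_augment_terminal.not.2 hT)] at hx
    have hz : z = x.2 := by
      by_contra h
      exact hx (by simp [h])
    subst hz
    simp only [if_true, one_mul] at hx
    obtain ⟨x₀, -, hx₀⟩ := Finset.exists_ne_zero_of_sum_ne_zero hx
    obtain ⟨r, -, hr⟩ := Finset.exists_ne_zero_of_sum_ne_zero (left_ne_zero_of_mul hx₀)
    rw [augment_p] at hr
    have hp := (stdSimplex.zero_le (P.p x₀.1 b.1) (x.1, r)).lt_of_ne'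
      (left_ne_zero_of_mul (left_ne_zero_of_mul hr))
    have hω := (stdSimplex.zero_le (P.ω x.1) x.2.2).lt_of_ne' (right_ne_zero_of_mul hr)
    have hf := (ih (right_ne_zero_of_mul hx₀)).2.2.2
    refine ⟨rfl, hT, hω, ?_⟩
    have ht : 0 < P.trans x₀.1 b.1 x.1 :=
      hp.trans_le (Finset.single_le_sum (f := fun r => P.p x₀.1 b.1 (x.1, r))
        (fun _ _ => stdSimplex.zero_le _ _) (Finset.mem_univ r))
    simp only [History.env, forward, POMDP.update, hT, if_false]
    refine mul_pos hω ((mul_pos ht hf).trans_le ?_)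
    exact Finset.single_le_sum (f := fun s => P.trans s b.1 x.1 * P.forward h.env s)
      (fun s _ => mul_nonneg (P.trans_nonneg _ _ _) ((P.isRunningWeight_forward _).nonneg s))
      (Finset.mem_univ x₀.1)

theorem augment_forward_start (x : S × M × O) (hx : x.1 ∉ P.terminal) :
    (P.augment N).forward (.start x.2) x = (P.augment N).μ x := by
  simp [forward, init, mem_augment_terminal, hx, augment_ω]

theorem augment_forward_step (h : History (M × O) (A × W)) (b : A × W) (x : S × M × O)
    (hx : x.1 ∉ P.terminal) : (P.augment N).forward (h.step b x.2) x =
      ∑ x₀, (P.augment N).trans x₀ b x * (P.augment N).forward h x₀ := by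
  simp [forward, POMDP.update, mem_augment_terminal, hx, augment_ω]

theorem sum_augment_ω_mul (x : S × M × O) (f : M × O → ℝ) :
    ∑ z, (P.augment N).ω x z * f z = f x.2 := by
  simp [augment_ω]

/-! ### Equal action probabilities give equal returns. -/

section Match

variable [Fintype A] [Fintype W] {πN : HistoryPolicy (M × O) (A × W)} {π : HistoryPolicy O A}

/-- The policies agree only on histories of positive probability, so the induction carries
positivity of both the policy weight and the forward weight. All other branches are multiplied by
zero. -/
theorem returnFrom_augment_eq
    (hπ : ∀ h, 0 < (P.augment N).historyProb πN h → ∀ a, ∑ w, πN h (a, w) = π h.env a)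
    (n : ℕ) (h : History (M × O) (A × W)) (x : S × M × O) (hh : 0 < πN.weight h)
    (hx : 0 < (P.augment N).forward h x) :
    (P.augment N).returnFrom πN n h x = P.returnFrom π n h.env x.1 := by
  induction n generalizing h x with
  | zero => simp [returnFrom]
  | succ n ih =>
    have hT := (augment_forward_ne_zero hx.ne').2.1
    have hfn := (P.augment N).isRunningWeight_forward h
    have h1 : ∀ b, πN h b * ∑ y, (P.augment N).p x b y * ((y.2 : ℝ) + (P.augment N).γ *
          ∑ z, (P.augment N).ω y.1 z * (P.augment N).returnFrom πN n (h.step b z) y.1) =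
        πN h b * ∑ y, P.p x.1 b.1 y * ((y.2 : ℝ) + P.γ *
          ∑ o, P.ω y.1 o * P.returnFrom π n (h.env.step b.1 o) y.1) := by
      intro b
      rcases (stdSimplex.zero_le (πN h) b).eq_or_lt with hb | hb
      · rw [← hb, zero_mul, zero_mul]
      congr 1
      have h2 : ∀ y, (P.augment N).p x b y * ((y.2 : ℝ) + (P.augment N).γ *
          ∑ z, (P.augment N).ω y.1 z * (P.augment N).returnFrom πN n (h.step b z) y.1) =
          (P.augment N).p x b y * ((y.2 : ℝ) + P.γ *
            P.returnFrom π n (h.env.step b.1 y.1.2.2) y.1.1) := by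
        intro y
        rw [sum_augment_ω_mul, augment_γ]
        rcases (stdSimplex.zero_le ((P.augment N).p x b) y).eq_or_lt with hy | hy
        · rw [← hy, zero_mul, zero_mul]
        by_cases hyT : y.1.1 ∈ P.terminal
        · rw [returnFrom_terminal P _ _ _ hyT,
            returnFrom_terminal (P.augment N) _ _ _ (mem_augment_terminal.2 hyT)]
        · rw [ih (h.step b y.1.2) y.1 (mul_pos hh hb)]
          · rfl
          · rw [augment_forward_step h b y.1 hyT]
            have ht : 0 < (P.augment N).trans x b y.1 :=
              hy.trans_le (Finset.single_le_sum (f := fun r => (P.augment N).p x b (y.1, r))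
                (fun _ _ => stdSimplex.zero_le _ _) (Finset.mem_univ y.2))
            exact (mul_pos ht hx).trans_le (Finset.single_le_sum
              (f := fun x₀ => (P.augment N).trans x₀ b y.1 * (P.augment N).forward h x₀)
              (fun x₀ _ => mul_nonneg (trans_nonneg _ _ _ _) (hfn.nonneg x₀))
              (Finset.mem_univ x))
      rw [Finset.sum_congr rfl fun y _ => h2 y, sum_augment_p_mul x b fun s r o =>
        (r : ℝ) + P.γ * P.returnFrom π n (h.env.step b.1 o) s]
      refine Finset.sum_congr rfl fun z _ => ?_
      congr 1
      simp_rw [mul_add, Finset.sum_add_distrib, ← Finset.sum_mul, stdSimplex.sum_eq_one, one_mul,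
        Finset.mul_sum]
      congr 1
      exact Finset.sum_congr rfl fun o _ => by ring
    have hp : 0 < (P.augment N).historyProb πN h :=
      mul_pos hh (hx.trans_le (Finset.single_le_sum (fun y _ => hfn.nonneg y)
        (Finset.mem_univ x)))
    simp only [returnFrom, mem_augment_terminal, hT, if_false]
    rw [Finset.sum_congr rfl fun b _ => h1 b, Fintype.sum_prod_type]
    simp_rw [← Finset.sum_mul, hπ h hp]

theorem returnUpTo_augment_eq
    (hπ : ∀ h, 0 < (P.augment N).historyProb πN h → ∀ a, ∑ w, πN h (a, w) = π h.env a)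
    (n : ℕ) : (P.augment N).returnUpTo πN n = P.returnUpTo π n := by
  have h1 : ∀ x, (P.augment N).μ x * ∑ z, (P.augment N).ω x z *
      (P.augment N).returnFrom πN n (.start z) x =
      (P.μ x.1 * N.η x.2.1 * P.ω x.1 x.2.2) * P.returnFrom π n (.start x.2.2) x.1 := by
    intro x
    rw [sum_augment_ω_mul, ← augment_μ]
    by_cases hT : x.1 ∈ P.terminal
    · rw [returnFrom_terminal P _ _ _ hT,
        returnFrom_terminal (P.augment N) _ _ _ (mem_augment_terminal.2 hT)]
    rcases (stdSimplex.zero_le (P.augment N).μ x).eq_or_lt with hx | hx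
    · rw [← hx, zero_mul, zero_mul]
    · rw [returnFrom_augment_eq hπ n (.start x.2) x zero_lt_one
        (by rwa [augment_forward_start x hT])]
      rfl
  rw [returnUpTo, Finset.sum_congr rfl fun x _ => h1 x, returnUpTo, Fintype.sum_prod_type]
  refine Finset.sum_congr rfl fun s _ => ?_
  rw [Fintype.sum_prod_type, Finset.sum_comm, Finset.mul_sum]
  refine Finset.sum_congr rfl fun o _ => ?_
  simp_rw [← Finset.sum_mul, ← Finset.mul_sum, stdSimplex.sum_eq_one]
  ring

end Match

/-! ### Memory that learns nothing from rewards cannot raise the value. -/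

section RewardInformation

/-- The weights of the states of the original POMDP after a history of the memory-augmented
environment. -/
noncomputable def envForward (P : POMDP S O A R) (N : ExternalMemory O A R M W)
    (h : History (M × O) (A × W)) : S → ℝ :=
  fun s => (P.augment N).forward h (s, h.last)

theorem sum_augment_forward_mul (h : History (M × O) (A × W)) (f : S × M × O → ℝ) :
    ∑ x, (P.augment N).forward h x * f x = ∑ s, P.envForward N h s * f (s, h.last) := by
  rw [Fintype.sum_prod_type]
  refine Finset.sum_congr rfl fun s _ => ?_
  refine Finset.sum_eq_single h.last (fun z _ hz => ?_) fun hz => absurd (Finset.mem_univ _) hz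
  have : (P.augment N).forward h (s, z) = 0 := by
    by_contra hne
    exact hz (augment_forward_ne_zero hne).1
  rw [this, zero_mul]

theorem envForward_start (z : M × O) :
    P.envForward N (.start z) = N.η z.1 • P.init z.2 := by
  funext s
  by_cases hs : s ∈ P.terminal
  · simp [envForward, forward, init, mem_augment_terminal, hs]
  · rw [envForward, History.last, augment_forward_start (s, z) hs, augment_μ]
    simp only [Pi.smul_apply, init, hs, if_false, smul_eq_mul]
    ring

/-- The rewards that can occur all induce one writing distribution `q`, which does not depend on the
hidden state. It therefore factors out of the filtering step as a scalar. -/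
theorem _root_.ExternalMemory.NoRewardInformation.exists_envForward_step
    (hN : N.NoRewardInformation P) (h : History (M × O) (A × W)) (b : A × W) (o : O) :
    ∃ q : stdSimplex ℝ M, ∀ m, P.envForward N (h.step b (m, o)) =
      q m • P.update (P.envForward N h) b.1 o := by
  obtain ⟨q, hq⟩ : ∃ q : stdSimplex ℝ M, ∀ r s s', s ∉ P.terminal → s' ∉ P.terminal →
      0 < P.ω s h.last.2 → 0 < P.p s b.1 (s', r) → 0 < P.ω s' o →
      N.Γ h.last.1 b.2 h.last.2 b.1 r o = q := by
    by_cases hr : ∃ r s s', s ∉ P.terminal ∧ s' ∉ P.terminal ∧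
      0 < P.ω s h.last.2 ∧ 0 < P.p s b.1 (s', r) ∧ 0 < P.ω s' o
    · obtain ⟨r₁, hr₁⟩ := hr
      exact ⟨_, fun r s s' h1 h2 h3 h4 h5 =>
        hN _ _ _ r r₁ ⟨s, s', h1, h2, h3, h4, h5⟩ hr₁ _ _⟩
    -- If no reward can occur here, any distribution serves; `N.η` is merely at hand.
    · exact ⟨N.η, fun r s s' h1 h2 h3 h4 h5 => absurd ⟨r, s, s', h1, h2, h3, h4, h5⟩ hr⟩
  refine ⟨q, fun m => funext fun s' => ?_⟩
  by_cases hs' : s' ∈ P.terminal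
  · simp [envForward, forward, POMDP.update, mem_augment_terminal, hs']
  rw [envForward, History.last, augment_forward_step h b (s', m, o) hs']
  simp_rw [mul_comm _ ((P.augment N).forward h _)]
  rw [sum_augment_forward_mul]
  simp only [Pi.smul_apply, POMDP.update, hs', if_false, smul_eq_mul, Finset.mul_sum]
  refine Finset.sum_congr rfl fun s _ => ?_
  -- Nonzero weight supplies what the choice of `q` requires of `s`: it is non-terminal and emits
  -- the last observation with positive probability.
  by_cases hs : P.envForward N h s = 0
  · simp [hs]
  obtain ⟨-, hT, hω, -⟩ := augment_forward_ne_zero hs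
  have h1 : (P.augment N).trans (s, h.last) b (s', m, o) =
      q m * (P.ω s' o * P.trans s b.1 s') := by
    simp_rw [trans, Finset.mul_sum]
    refine Finset.sum_congr rfl fun r _ => ?_
    rw [augment_p]
    dsimp only
    rcases (stdSimplex.zero_le (P.p s b.1) (s', r)).eq_or_lt with hp | hp
    · simp [← hp]
    rcases (stdSimplex.zero_le (P.ω s') o).eq_or_lt with ho | ho
    · simp [← ho]
    rw [hq r s s' hT hs' hω hp ho]
    ring
  rw [h1]
  ring

variable [Fintype A] [Fintype W] [Nonempty A]

/-- The belief after a step is the ordinary update scaled by `q m`. By homogeneity these scalars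
leave the optimal return and sum to one. The bound covers every history-based policy of the
augmented environment. -/
theorem _root_.ExternalMemory.NoRewardInformation.expectedReturn_le
    (hN : N.NoRewardInformation P) (πN : HistoryPolicy (M × O) (A × W)) (n : ℕ)
    (h : History (M × O) (A × W)) :
    (P.augment N).expectedReturn πN n h ≤ P.optimalReturn n (P.envForward N h) := by
  induction n generalizing h with
  | zero => simp [expectedReturn, returnFrom, optimalReturn]
  | succ n ih =>
    rw [expectedReturn_succ]
    refine stdSimplex.sum_mul_le _ fun b =>
      le_trans ?_ (P.actionValue_le_optimalReturn n (P.envForward N h) b.1)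
    rw [sum_augment_forward_mul]
    simp_rw [augment_reward]
    refine add_le_add le_rfl (mul_le_mul_of_nonneg_left ?_ P.γ_nonneg)
    rw [Fintype.sum_prod_type, Finset.sum_comm]
    refine Finset.sum_le_sum fun o _ => ?_
    obtain ⟨q, hq⟩ := hN.exists_envForward_step h b o
    calc ∑ m, (P.augment N).expectedReturn πN n (h.step b (m, o))
        ≤ ∑ m, q m * P.optimalReturn n (P.update (P.envForward N h) b.1 o) := by
          refine Finset.sum_le_sum fun m _ => (ih _).trans_eq ?_
          rw [hq m, P.optimalReturn_smul n (stdSimplex.zero_le _ _)]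
      _ = _ := by rw [← Finset.sum_mul, stdSimplex.sum_eq_one, one_mul]

theorem _root_.ExternalMemory.NoRewardInformation.returnUpTo_le
    (hN : N.NoRewardInformation P) (πN : HistoryPolicy (M × O) (A × W)) (n : ℕ) :
    (P.augment N).returnUpTo πN n ≤ P.optimalReturnUpTo n := by
  rw [returnUpTo_eq_sum_expectedReturn, optimalReturnUpTo, Fintype.sum_prod_type,
    Finset.sum_comm]
  refine Finset.sum_le_sum fun o _ => ?_
  calc ∑ m, (P.augment N).expectedReturn πN n (.start (m, o))
      ≤ ∑ m, N.η m * P.optimalReturn n (P.init o) := by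
        refine Finset.sum_le_sum fun m _ => (hN.expectedReturn_le πN n _).trans_eq ?_
        rw [envForward_start, P.optimalReturn_smul n (stdSimplex.zero_le _ _)]
    _ = _ := by rw [← Finset.sum_mul, stdSimplex.sum_eq_one, one_mul]

end RewardInformation

/-! ### Reading the belief off the memory. -/

/-- With sufficiently expressive memory, some memoryless policy acts like a given deterministic
belief-based policy. -/
theorem exists_memoryless_eq_beliefPolicy [Fintype A] [Fintype W]
    (hN : N.SufficientlyExpressive P) (act : (S → ℝ) → A) :
    ∃ πN : MemorylessPolicy (M × O) (A × W),
      ∀ h : History (M × O) (A × W), 0 < (P.augment N).historyProb πN.toHistory h →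
        ∀ a, ∑ w, πN h.last (a, w) = P.beliefPolicy act h.env a := by
  classical
  obtain ⟨f, hf⟩ := hN
  -- Two histories with the same last observation and a common last memory state cannot have
  -- different beliefs. So the belief is a function of `z`, with junk value `0` where no history
  -- leads to `z`.
  have hbel : ∀ z : M × O, ∃ b : S → ℝ, ∀ H, P.Possible H → H.last = z.2 →
      z.1 ∈ N.lastMemoryStates P f H → P.belief H = b := by
    intro z
    by_cases hz : ∃ H, P.Possible H ∧ H.last = z.2 ∧ z.1 ∈ N.lastMemoryStates P f H
    · obtain ⟨H₀, h1, h2, h3⟩ := hz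
      refine ⟨P.belief H₀, fun H h1' h2' h3' => ?_⟩
      by_contra hne
      exact Set.disjoint_left.1 (hf H H₀ h1' h1 (h2'.trans h2.symm) hne) h3' h3
    · exact ⟨0, fun H h1 h2 h3 => absurd ⟨H, h1, h2, h3⟩ hz⟩
  choose b hb using hbel
  set πN : MemorylessPolicy (M × O) (A × W) := fun z =>
    stdSimplex.vertex (act (b z), f (z.1, z.2, act (b z))) with hπN
  -- The policy is a point mass whose writing action is given by `f`. A history of nonzero weight
  -- thus follows `f`, which puts its last memory state into `lastMemoryStates`.
  have hfollows : ∀ h : History (M × O) (A × W),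
      HistoryPolicy.weight πN.toHistory h ≠ 0 → h.Follows f := by
    intro h
    induction h with
    | start z => exact fun _ => trivial
    | step h c z ih =>
      intro hne
      refine ⟨ih (left_ne_zero_of_mul hne), ?_⟩
      have hc : πN h.last c ≠ 0 := right_ne_zero_of_mul hne
      have hc' : c = (act (b h.last), f (h.last.1, h.last.2, act (b h.last))) := by
        by_contra hcne
        exact hc (by simp [hπN, hcne])
      rw [hc']
  refine ⟨πN, fun h hh a => ?_⟩
  have hweight : HistoryPolicy.weight πN.toHistory h ≠ 0 := left_ne_zero_of_mul hh.ne'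
  obtain ⟨x, -, hx⟩ := Finset.exists_ne_zero_of_sum_ne_zero (right_ne_zero_of_mul hh.ne')
  have hxpos := (((P.augment N).isRunningWeight_forward h).nonneg x).lt_of_ne' hx
  have hbelief : P.belief h.env = b h.last :=
    hb h.last h.env ⟨x.1, (augment_forward_ne_zero hx).2.2.2⟩ (History.env_last h)
      ⟨h, rfl, hfollows h hweight, ⟨x, hxpos⟩, rfl⟩
  simp only [beliefPolicy, hbelief, hπN, stdSimplex.vertex_coe]
  by_cases ha : a = act (b h.last)
  · subst ha
    simp [Pi.single_apply]
  · simp [ha]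

end Augment

end POMDP

/-! ### Assembly. -/

theorem mainTheorem2 {S O A M W : Type*} [Fintype S] [Fintype O] [Fintype A] [Fintype M]
    [Fintype W] [Nonempty A] {R : Finset ℝ} (P : POMDP S O A R)
    (hγ : P.γ < 1 ∨ P.EpisodesEnd) (N : ExternalMemory O A R M W)
    (hN : N.SufficientlyExpressive P) :
    -- all expected discounted returns exist
    (∀ π : HistoryPolicy O A, ∃ v, P.HasValue π v) ∧
    (∀ π : MemorylessPolicy (M × O) (A × W), ∃ v, (P.augment N).HasValue π.toHistory v) ∧
    -- optimal policies exist
    (∃ π : HistoryPolicy O A, P.IsOptimal π) ∧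
    (∃ π : MemorylessPolicy (M × O) (A × W), (P.augment N).IsOptimalMemoryless π) ∧
    -- an optimal memoryless policy with memory is as good as an optimal history-based policy
    (∀ (πN : MemorylessPolicy (M × O) (A × W)) (π : HistoryPolicy O A) (vN v : ℝ),
      (P.augment N).IsOptimalMemoryless πN → P.IsOptimal π →
      (P.augment N).HasValue πN.toHistory vN → P.HasValue π v →
        v ≤ vN ∧ (N.NoRewardInformation P → vN = v)) ∧
    -- some memoryless policy with memory acts exactly like an optimal history-based policy
    (∃ (πN : MemorylessPolicy (M × O) (A × W)) (π : HistoryPolicy O A), P.IsOptimal π ∧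
      ∀ h : History (M × O) (A × W), 0 < (P.augment N).historyProb πN.toHistory h →
        ∀ a, ∑ w, πN h.last (a, w) = π h.env a) := by
  obtain ⟨w, ρ, hw⟩ := P.exists_contractingWeight hγ
  have hwN := hw.augment N
  obtain ⟨act, V, hV, hopt⟩ := hw.exists_optimal_beliefPolicy
  have hle : ∀ π v, P.HasValue π v → v ≤ V := fun π v hv =>
    le_of_tendsto_of_tendsto' hv hopt (P.returnUpTo_le_optimalReturnUpTo π)
  obtain ⟨πN, hπN⟩ := P.exists_memoryless_eq_beliefPolicy hN act
  have hVN : (P.augment N).HasValue πN.toHistory V := by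
    rw [POMDP.HasValue, funext (POMDP.returnUpTo_augment_eq hπN)]
    exact hV
  -- Nonemptiness of `W` is not assumed. It follows because the initial distribution forces `M × O`
  -- to be inhabited, and `πN` then provides a probability vector on `A × W`.
  have : Nonempty (A × W) := by
    obtain ⟨z⟩ : Nonempty (M × O) := by
      by_contra hne
      rw [not_nonempty_iff] at hne
      simpa using stdSimplex.sum_eq_one (P.augment N).μ
    by_contra hne
    rw [not_nonempty_iff] at hne
    simpa using stdSimplex.sum_eq_one (πN z)
  refine ⟨hw.exists_hasValue, fun π => hwN.exists_hasValue π.toHistory,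
    ⟨_, V, hV, hle⟩, hwN.exists_isOptimalMemoryless, ?_, πN, _, ⟨V, hV, hle⟩, hπN⟩
  intro πN' π vN v ⟨vN', hvN', hmaxN⟩ ⟨v', hv', hmax⟩ hvN hv
  -- By uniqueness of limits every optimal history-based policy has value `V`. The copying policy
  -- `πN` bounds the memoryless optimum below by `V`, and the reward condition bounds it above.
  rw [tendsto_nhds_unique hvN hvN', tendsto_nhds_unique hv hv',
    le_antisymm (hle π v' hv') (hmax _ V hV)]
  exact ⟨hmaxN πN V hVN, fun hR => le_antisymm
    (le_of_tendsto_of_tendsto' hvN' hopt (hR.returnUpTo_le _)) (hmaxN πN V hVN)⟩
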